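/- Let $(p_n)_{n\ge 0}$ be a sequence of pairwise distinct primes and, for every $t\ge 2$, let $A_t$ be an alphabet of size $t$. For a finite set $A$, an $A$-generated group is a group $G$ together with a (not necessarily injective) map $\varphi:A\to G$ whose image generates $G$; a quotient of an $A$-generated group $(G,\varphi)$ is an $A$-generated group $(H,\psi)$ for which there is a surjective homomorphism $\chi:G\to H$ with $\chi\circ\varphi=\psi$. For a finite $A$-generated group $G=F/R$, where $F$ is the free group on $A$, let $G^{\mathbb{Z}/p}:=F/R^p[R,R]$ be its universal Gaschütz $p$-extension and put $G^{\widetilde{\mathbb{Z}/p}}:=G^{\mathbb{Z}/p}/Z(G^{\mathbb{Z}/p})$, again $A$-generated by the images of the letters. If $|A|\ge 2$ then $Z(G^{\mathbb{Z}/p})$ lies in the kernel of $G^{\mathbb{Z}/p}\twoheadrightarrow G$, so there is a canonical morphism $G^{\widetilde{\mathbb{Z}/p}}\twoheadrightarrow G$ fixing the letters. For $t\ge 2$ set $G_{0t}:=(\mathbb{Z}/p_0\mathbb{Z})^{A_t}$, generated by its standard basis, and $G_{nt}:=G_{n-1,t}^{\widetilde{\mathbb{Z}/p_n}}$ for $n\ge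 1$; let $\mathcal{G}_t:=\varprojlim_{n\ge 0}G_{nt}$ be the inverse limit along the canonical morphisms, a topological group topologized as a subgroup of the product of the discrete groups $G_{nt}$. Let $\mathfrak{F}$ be the class of all groups that are quotients of some $G_{nt}$ with $n\ge 0$, $t\ge 2$. A pro-$\mathfrak{F}$ group is a profinite group all of whose quotients by open normal subgroups belong to $\mathfrak{F}$. A free pro-$\mathfrak{F}$ group on a finite set $X$ is a pro-$\mathfrak{F}$ group $H$ with a map $\iota:X\to H$ such that $\iota(X)$ generates $H$ topologically and such that for every pro-$\mathfrak{F}$ group $K$ and every map $\mu:X\to K$ whose image generates $K$ topologically there is a unique continuous homomorphism $f:H\to K$ with $f\circ\iota=\mu$. **Theorem.** For every $t\ge 2$: 1. The $A_t$-generated members of $\mathfrak{F}$ are exactly the quotients (as $A_t$-generated groups) of the groups $G_{nt}$, $n\ge 0$; that is, for a group $G$ and a map $\varphi:A_t\to G$, the image $\varphi(A_t)$ generates $G$ and $G\in\mathfrak{F}$ if and only if for some $n\ge 0$ there is a surjective homomorphism $G_{nt}\to G$ sending each letter $a\in A_t$ to $\varphi(a)$. 2. $\mathcal{G}_t$, with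 its standard generators $A_t\to\mathcal{G}_t$, is the $A_t$-generated free pro-$\mathfrak{F}$ group, i.e. a free pro-$\mathfrak{F}$ group on $A_t$. -/

import Mathlib

universe u v

namespace GaschutzTower

/-- A finite `A`-generated group: a finite group `G` together with a (not necessarily injective)
map `gen : A → G` whose image generates `G`. -/
structure GenGroup (A : Type u) where
  carrier : Type u
  group : Group carrier
  finite : Finite carrier
  gen : A → carrier
  closure_range_gen : Subgroup.closure (Set.range gen) = ⊤

instance {A : Type u} : CoeSort (GenGroup A) (Type u) := ⟨GenGroup.carrier⟩

attribute [instance] GenGroup.group GenGroup.finite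

/-- Finite `A`-generated groups are regarded as discrete topological groups. -/
instance {A : Type u} (G : GenGroup A) : TopologicalSpace G := ⊥

instance {A : Type u} (G : GenGroup A) : DiscreteTopology G := ⟨rfl⟩

/-- The canonical morphism `F ↠ G` from the free group on `A`. -/
def GenGroup.eval {A : Type u} (G : GenGroup A) : FreeGroup A →* G := FreeGroup.lift G.gen

theorem GenGroup.eval_of {A : Type u} (G : GenGroup A) (a : A) :
    G.eval (FreeGroup.of a) = G.gen a := FreeGroup.lift_apply_of

theorem GenGroup.eval_surjective {A : Type u} (G : GenGroup A) :
    Function.Surjective G.eval := by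
  rw [← MonoidHom.range_eq_top, GenGroup.eval, FreeGroup.range_lift_eq_closure]
  exact G.closure_range_gen

/-- The subgroup `R^p [R, R]` of a group, for a normal subgroup `R`. -/
def powCommutator {F : Type u} [Group F] (p : ℕ) (R : Subgroup F) : Subgroup F :=
  Subgroup.normalClosure ((fun x => x ^ p) '' (R : Set F)) ⊔ ⁅R, R⁆

instance {F : Type u} [Group F] (p : ℕ) (R : Subgroup F) [R.Normal] :
    (powCommutator p R).Normal := by
  unfold powCommutator; infer_instance

theorem powCommutator_le {F : Type u} [Group F] (p : ℕ) (R : Subgroup F) [R.Normal] :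
    powCommutator p R ≤ R := by
  refine sup_le (Subgroup.normalClosure_le_normal ?_) (Subgroup.commutator_le_left R R)
  rintro _ ⟨x, hx, rfl⟩
  exact R.pow_mem hx p

open scoped commutatorElement in
theorem finite_quotient_powCommutator {F : Type u} [Group F] [Group.FG F] (p : ℕ) (hp : 0 < p)
    (R : Subgroup F) [R.Normal] [R.FiniteIndex] : Finite (F ⧸ powCommutator p R) := by
  let q := QuotientGroup.mk' (powCommutator p R)
  have hq : Function.Surjective q := QuotientGroup.mk'_surjective _
  let M : Subgroup (F ⧸ powCommutator p R) := R.map q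
  have hMi : M.index ≠ 0 := by
    have h := Subgroup.index_map_dvd R (f := q) hq
    exact fun h0 => Subgroup.FiniteIndex.index_ne_zero (H := R) (by simpa [M, h0] using h)
  have : M.FiniteIndex := ⟨hMi⟩
  have : Finite ((F ⧸ powCommutator p R) ⧸ M) := Subgroup.finite_quotient_of_finiteIndex
  have hcomm : ∀ x y : M, x * y = y * x := by
    rintro ⟨_, r, hr, rfl⟩ ⟨_, s, hs, rfl⟩
    apply Subtype.ext
    change q r * q s = q s * q r
    have h : q ⁅r, s⁆ = 1 := (QuotientGroup.eq_one_iff _).2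
      (Subgroup.mem_sup_right (Subgroup.commutator_mem_commutator hr hs))
    rw [map_commutatorElement] at h
    exact commutatorElement_eq_one_iff_mul_comm.1 h
  let cM : CommGroup M := { (inferInstance : Group M) with mul_comm := hcomm }
  have hfg : @Group.FG M cM.toGroup := Subgroup.fg_of_index_ne_zero M
  have : Finite M := by
    refine @CommGroup.finite_of_fg_isMulTorsion M cM hfg ?_
    rintro ⟨_, r, hr, rfl⟩
    refine isOfFinOrder_iff_pow_eq_one.2 ⟨p, hp, Subtype.ext ?_⟩
    change q r ^ p = 1
    rw [← map_pow]
    exact (QuotientGroup.eq_one_iff _).2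
      (Subgroup.mem_sup_left (Subgroup.subset_normalClosure ⟨r, hr, rfl⟩))
  exact Finite.of_subgroup_quotient M

/-- The `A`-generated group `(ℤ/p)^A`, generated by its standard basis. -/
noncomputable def base (A : Type u) [Finite A] (p : ℕ) [Fact p.Prime] : GenGroup A := by
  classical
  exact
  { carrier := A → Multiplicative (ZMod p)
    group := inferInstance
    finite := inferInstance
    gen := fun a => Pi.mulSingle a (Multiplicative.ofAdd 1)
    closure_range_gen := by
      rw [eq_top_iff]
      intro x _
      refine Subgroup.pi_mem_of_mulSingle_mem x fun a => ?_
      have h : (Pi.mulSingle a (x a) : A → Multiplicative (ZMod p)) =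
          (Pi.mulSingle a (Multiplicative.ofAdd 1)) ^ (Multiplicative.toAdd (x a)).val := by
        rw [← Pi.mulSingle_pow]
        congr 1
        rw [← ofAdd_nsmul]
        simp
      rw [h]
      exact Subgroup.pow_mem _ (Subgroup.subset_closure (Set.mem_range_self a)) _ }

/-- The universal Gaschütz `p`-extension `F / R^p [R, R]` of the `A`-generated group `G = F / R`,
where `F` is the free group on `A`. -/
def gaschutz {A : Type u} [Finite A] (p : ℕ) [Fact p.Prime] (G : GenGroup A) : GenGroup A where
  carrier := FreeGroup A ⧸ powCommutator p G.eval.ker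
  group := inferInstance
  finite := finite_quotient_powCommutator p (Fact.out : p.Prime).pos _
  gen := fun a => QuotientGroup.mk' _ (FreeGroup.of a)
  closure_range_gen := by
    have h := FreeGroup.closure_range_of A
    rw [Set.range_comp' (QuotientGroup.mk' _) FreeGroup.of, ← MonoidHom.map_closure, h,
      ← MonoidHom.range_eq_map, MonoidHom.range_eq_top]
    exact QuotientGroup.mk'_surjective _

/-- The quotient `G / Z(G)`, generated by the images of the generators of `G`. -/
def modCenter {A : Type u} (G : GenGroup A) : GenGroup A where
  carrier := G ⧸ Subgroup.center G
  group := inferInstance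
  finite := inferInstance
  gen := fun a => QuotientGroup.mk' _ (G.gen a)
  closure_range_gen := by
    rw [Set.range_comp' (QuotientGroup.mk' _) G.gen, ← MonoidHom.map_closure,
      G.closure_range_gen, ← MonoidHom.range_eq_map, MonoidHom.range_eq_top]
    exact QuotientGroup.mk'_surjective _

/-- The tower `G₀ = (ℤ/p₀)^A`, `Gₙ₊₁ = E / Z(E)` where `E` is the Gaschütz `pₙ₊₁`-extension
of `Gₙ`. -/
noncomputable def tower (p : ℕ → ℕ) [∀ n, Fact (p n).Prime] (A : Type u) [Finite A] :
    ℕ → GenGroup A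
  | 0 => base A (p 0)
  | n + 1 => modCenter (gaschutz (p (n + 1)) (tower p A n))

/-- The canonical morphism from the Gaschütz extension of `G` to `G`. -/
def gaschutzProj {A : Type u} [Finite A] (p : ℕ) [Fact p.Prime] (G : GenGroup A) :
    gaschutz p G →* G :=
  QuotientGroup.lift (powCommutator p G.eval.ker) G.eval (powCommutator_le p G.eval.ker)

section Center

variable {A : Type u} (p : ℕ) (G : GenGroup A)

open Classical in
/-- The letter `c` acts on `G × ℤ/p` by left multiplication on the first coordinate, raising the
second one by `1` exactly when `c = b` and the first coordinate is `1`. -/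
noncomputable def countPerm (b c : A) : Equiv.Perm (G × ZMod p) where
  toFun q := (G.gen c * q.1, q.2 + if c = b ∧ q.1 = 1 then 1 else 0)
  invFun q := ((G.gen c)⁻¹ * q.1, q.2 - if c = b ∧ (G.gen c)⁻¹ * q.1 = 1 then 1 else 0)
  left_inv q := by ext <;> simp
  right_inv q := by ext <;> simp

theorem exists_count (b : A) (w : FreeGroup A) : ∃ f : G → ZMod p, ∀ q,
    FreeGroup.lift (countPerm p G b) w q = (G.eval w * q.1, q.2 + f q.1) := by
  induction w using FreeGroup.induction_on with
  | C1 => exact ⟨0, fun q => by simp⟩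
  | of c =>
    classical
    exact ⟨fun h => if c = b ∧ h = 1 then 1 else 0, fun q => by
      rw [G.eval_of, FreeGroup.lift_apply_of]; rfl⟩
  | inv_of c _ =>
    classical
    refine ⟨fun h => - if c = b ∧ (G.gen c)⁻¹ * h = 1 then 1 else 0, fun q => ?_⟩
    rw [map_inv, map_inv, G.eval_of, FreeGroup.lift_apply_of, ← sub_eq_add_neg]
    rfl
  | mul x y hx hy =>
    obtain ⟨f, hf⟩ := hx
    obtain ⟨g, hg⟩ := hy
    refine ⟨fun h => g h + f (G.eval y * h), fun q => ?_⟩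
    rw [map_mul, map_mul, Equiv.Perm.mul_apply, hg, hf]
    simp [mul_assoc, add_assoc]

open scoped commutatorElement in
theorem powCommutator_le_ker (b : A) :
    powCommutator p G.eval.ker ≤ (FreeGroup.lift (countPerm p G b)).ker := by
  refine sup_le (Subgroup.normalClosure_le_normal ?_) (Subgroup.commutator_le.2 ?_)
  · rintro _ ⟨r, hr, rfl⟩
    obtain ⟨f, hf⟩ := exists_count p G b r
    rw [SetLike.mem_coe, MonoidHom.mem_ker] at hr
    have h : ∀ (k : ℕ) q, ((FreeGroup.lift (countPerm p G b) r) ^ k) q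
        = (q.1, q.2 + k * f q.1) := by
      intro k
      induction k with
      | zero => intro q; simp
      | succ k ih =>
        intro q
        rw [pow_succ', Equiv.Perm.mul_apply, ih, hf, hr]
        ext
        · simp
        · push_cast; ring
    change FreeGroup.lift (countPerm p G b) (r ^ p) = 1
    rw [map_pow]
    ext q <;> simp [h]
  · intro r hr s hs
    obtain ⟨f, hf⟩ := exists_count p G b r
    obtain ⟨g, hg⟩ := exists_count p G b s
    rw [MonoidHom.mem_ker] at hr hs
    rw [MonoidHom.mem_ker, map_commutatorElement, commutatorElement_eq_one_iff_mul_comm]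
    ext q <;> simp only [Equiv.Perm.mul_apply, hf, hg, hr, hs, one_mul]
    ring

theorem exists_invariant [Finite A] [Fact p.Prime] (z : FreeGroup A)
    (hz : QuotientGroup.mk' (powCommutator p G.eval.ker) z ∈ Subgroup.center _) (b : A) :
    ∃ f : G → ZMod p, (∀ c ≠ b, ∀ h, f (G.gen c * h) = f h) ∧
      (∀ h, f (G.gen b * h) + (open Classical in if h = 1 then 1 else 0) =
        f h + (open Classical in if G.eval z * h = 1 then 1 else 0)) := by
  classical
  obtain ⟨f, hf⟩ := exists_count p G b z
  have key : ∀ c q, FreeGroup.lift (countPerm p G b) z (countPerm p G b c q) =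
      countPerm p G b c (FreeGroup.lift (countPerm p G b) z q) := by
    intro c q
    have h := Subgroup.mem_center_iff.1 hz (QuotientGroup.mk' _ (FreeGroup.of c))
    rw [← map_mul, ← map_mul] at h
    have h2 := powCommutator_le_ker p G b (QuotientGroup.eq.1 h)
    rw [MonoidHom.mem_ker, map_mul, map_inv, inv_mul_eq_one, map_mul, map_mul,
      FreeGroup.lift_apply_of] at h2
    have h3 := congrArg (fun e : Equiv.Perm (G × ZMod p) => e q) h2
    exact h3.symm
  refine ⟨f, fun c hc h => ?_, fun h => ?_⟩
  · have h1 := congrArg Prod.snd (key c (h, 0))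
    simpa [hf, countPerm, hc] using h1
  · have h1 := congrArg Prod.snd (key b (h, 0))
    simp only [hf, countPerm, Equiv.coe_fn_mk, true_and, zero_add] at h1
    rw [add_comm, h1]

/-- The centre of the Gaschütz extension lies in the kernel of the canonical morphism onto `G`,
so that `Gₙ` is a canonical quotient of `Gₙ₊₁`. -/
theorem center_le_ker [Finite A] [Nontrivial A] [Fact p.Prime] :
    Subgroup.center (gaschutz p G) ≤ (gaschutzProj p G).ker := by
  classical
  intro x hx
  obtain ⟨z, rfl⟩ := QuotientGroup.mk'_surjective (powCommutator p G.eval.ker) x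
  change G.eval z = 1
  by_contra hg
  set g := G.eval z with hgdef
  have key : ∀ b : A, ∃ f : G → ZMod p, (∀ c ≠ b, ∀ h, f (G.gen c * h) = f h) ∧
      (∀ k : ℕ, f (G.gen b ^ k) + ((Finset.range k).filter (fun j => G.gen b ^ j = 1)).card =
        f 1 + ((Finset.range k).filter (fun j => g * G.gen b ^ j = 1)).card) := by
    intro b
    obtain ⟨f, h1, h2⟩ := exists_invariant p G z hx b
    refine ⟨f, h1, fun k => ?_⟩
    induction k with
    | zero => simp
    | succ k ih =>
      have h3 := h2 (G.gen b ^ k)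
      rw [← pow_succ'] at h3
      rw [Finset.range_add_one, Finset.filter_insert, Finset.filter_insert]
      rw [apply_ite Finset.card, apply_ite Finset.card, Finset.card_insert_of_notMem (by simp),
        Finset.card_insert_of_notMem (by simp), Nat.cast_ite, Nat.cast_ite]
      push_cast
      rw [← hgdef] at h3
      split_ifs at h3 ⊢ <;> linear_combination ih + h3
  have hmem : ∀ b : A, ∃ k, g * G.gen b ^ k = 1 ∧ k < orderOf (G.gen b) := by
    intro b
    obtain ⟨f, -, h⟩ := key b
    have h := h (orderOf (G.gen b))
    by_contra! hcon
    have e1 : (Finset.range (orderOf (G.gen b))).filter (fun j => g * G.gen b ^ j = 1) = ∅ := by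
      rw [Finset.filter_eq_empty_iff]
      intro j hj hj'
      exact absurd (Finset.mem_range.1 hj) (not_lt.2 (hcon j hj'))
    have e2 : (Finset.range (orderOf (G.gen b))).filter (fun j => G.gen b ^ j = 1) = {0} := by
      ext j
      simp only [Finset.mem_filter, Finset.mem_range, Finset.mem_singleton]
      constructor
      · rintro ⟨hj, hj'⟩
        by_contra h0
        exact pow_ne_one_of_lt_orderOf h0 hj hj'
      · rintro rfl
        exact ⟨orderOf_pos _, pow_zero _⟩
    rw [e1, e2, pow_orderOf_eq_one] at h
    simp at h
  obtain ⟨a, b, hab⟩ := exists_pair_ne A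
  obtain ⟨f, h1, h2⟩ := key b
  obtain ⟨l, hl, -⟩ := hmem a
  obtain ⟨k, hk, hko⟩ := hmem b
  have hinv : ∀ l : ℕ, f (G.gen a ^ l) = f 1 := by
    intro l
    induction l with
    | zero => simp
    | succ l ih => rw [pow_succ', h1 a hab, ih]
  have hgk : G.gen b ^ k = G.gen a ^ l := by
    rw [← inv_eq_of_mul_eq_one_right hk, ← inv_eq_of_mul_eq_one_right hl]
  have h3 := h2 k
  rw [hgk, hinv] at h3
  have hk0 : 0 < k := by
    rcases Nat.eq_zero_or_pos k with h0 | h0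
    · subst h0
      rw [pow_zero, mul_one] at hk
      exact absurd hk hg
    · exact h0
  have e1 : (Finset.range k).filter (fun j => g * G.gen b ^ j = 1) = ∅ := by
    rw [Finset.filter_eq_empty_iff]
    intro j hj hj'
    have hjk := Finset.mem_range.1 hj
    have h4 : G.gen b ^ j = G.gen b ^ k := mul_left_cancel (hj'.trans hk.symm)
    exact absurd (pow_injOn_Iio_orderOf (Set.mem_Iio.2 (hjk.trans hko)) (Set.mem_Iio.2 hko) h4)
      hjk.ne
  have e2 : (Finset.range k).filter (fun j => G.gen b ^ j = 1) = {0} := by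
    ext j
    simp only [Finset.mem_filter, Finset.mem_range, Finset.mem_singleton]
    constructor
    · rintro ⟨hj, hj'⟩
      by_contra h0
      exact pow_ne_one_of_lt_orderOf h0 (hj.trans hko) hj'
    · rintro rfl
      exact ⟨hk0, pow_zero _⟩
  rw [e1, e2] at h3
  simp at h3

end Center

/-- The canonical morphism `Gₙ₊₁ ↠ Gₙ`. -/
noncomputable def transition (p : ℕ → ℕ) [∀ n, Fact (p n).Prime] (A : Type u) [Finite A]
    [Nontrivial A] (n : ℕ) : tower p A (n + 1) →* tower p A n :=
  QuotientGroup.lift (Subgroup.center (gaschutz (p (n + 1)) (tower p A n)))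
    (gaschutzProj (p (n + 1)) (tower p A n)) (center_le_ker (p (n + 1)) (tower p A n))

theorem transition_gen (p : ℕ → ℕ) [∀ n, Fact (p n).Prime] (A : Type u) [Finite A]
    [Nontrivial A] (n : ℕ) (a : A) :
    transition p A n ((tower p A (n + 1)).gen a) = (tower p A n).gen a :=
  (tower p A n).eval_of a

/-- The inverse limit of the tower `⋯ ↠ G₂ ↠ G₁ ↠ G₀`, with the topology inherited from the
product of the discrete groups `Gₙ`. -/
noncomputable def limit (p : ℕ → ℕ) [∀ n, Fact (p n).Prime] (A : Type u) [Finite A]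
    [Nontrivial A] : Subgroup (∀ n, tower p A n) where
  carrier := {x | ∀ n, transition p A n (x (n + 1)) = x n}
  mul_mem' hx hy n := by simp only [Pi.mul_apply, map_mul, hx n, hy n]
  one_mem' n := by simp only [Pi.one_apply, map_one]
  inv_mem' hx n := by simp only [Pi.inv_apply, map_inv, hx n]

/-- The standard generators of the inverse limit. -/
noncomputable def limitGen (p : ℕ → ℕ) [∀ n, Fact (p n).Prime] (A : Type u) [Finite A]
    [Nontrivial A] (a : A) : limit p A :=
  ⟨fun n => (tower p A n).gen a, fun n => transition_gen p A n a⟩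

/-- Membership in the class `𝔉` of all quotients of all groups `G_{nt}`, `n ≥ 0`, `t ≥ 2`, where
`G_{nt}` is the `n`-th term of the tower over the alphabet `A t`. -/
def InClass (p : ℕ → ℕ) [∀ n, Fact (p n).Prime] (A : ℕ → Type u) [∀ t, Finite (A t)]
    (G : Type v) [Group G] : Prop :=
  ∃ n t : ℕ, 2 ≤ t ∧ ∃ f : tower p (A t) n →* G, Function.Surjective f

/-- Pro-`𝔉` groups: profinite groups all of whose quotients by open normal subgroups lie
in `𝔉`. -/
structure IsPro (p : ℕ → ℕ) [∀ n, Fact (p n).Prime] (A : ℕ → Type u) [∀ t, Finite (A t)]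
    (H : Type v) [Group H] [TopologicalSpace H] : Prop where
  isTopologicalGroup : IsTopologicalGroup H
  compactSpace : CompactSpace H
  t2Space : T2Space H
  totallyDisconnectedSpace : TotallyDisconnectedSpace H
  quotient_mem : ∀ (N : Subgroup H) [N.Normal], IsOpen (N : Set H) → InClass p A (H ⧸ N)

/-- `(H, ι)` is the free pro-`𝔉` group on the finite set `X` (with respect to pro-`𝔉` groups
in the universe `v`): `H` is pro-`𝔉`, topologically generated by `ι(X)`, and every map from `X`
onto a topological generating family of a pro-`𝔉` group `K` extends uniquely to a continuous
morphism `H → K`. -/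
structure IsFreePro.{w, x, y} (p : ℕ → ℕ) [∀ n, Fact (p n).Prime] (A : ℕ → Type u)
    [∀ t, Finite (A t)] (X : Type w) (H : Type x) [Group H] [TopologicalSpace H]
    (ι : X → H) : Prop where
  isPro : IsPro p A H
  dense : Dense (Subgroup.closure (Set.range ι) : Set H)
  lift : ∀ (K : Type y) [Group K] [TopologicalSpace K], IsPro p A K →
    ∀ μ : X → K, Dense (Subgroup.closure (Set.range μ) : Set K) →
      ∃! f : H →ₜ* K, ∀ a, f (ι a) = μ a

end GaschutzTower

namespace GaschutzTower

/-- If `f : E →* G` kills the centre and `W` is an abelian kernel of a surjection onto a finite group of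
order prime to `p`, then the image of `W` contains no nontrivial central element of order `p`. -/
theorem map_eq_one_of_mem_center {E : Type u} {Q : Type u} {G : Type v} [Group E] [Group Q] [Finite Q]
    [Group G] (π : E →* Q) (hπ : Function.Surjective π)
    (hcomm : ∀ x ∈ π.ker, ∀ y ∈ π.ker, x * y = y * x) (f : E →* G) (hZ : Subgroup.center E ≤ f.ker) {p : ℕ}
    (hp : p.Coprime (Nat.card Q)) {x : E} (hx : x ∈ π.ker) (hxp : x ^ p = 1)
    (hfx : f x ∈ Subgroup.center G) : f x = 1 := by
  classical
  have := Fintype.ofFinite Q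
  let s := Function.surjInv hπ
  have hs : ∀ q, π (s q) = q := Function.surjInv_eq hπ
  let cW : CommGroup π.ker :=
    { (inferInstance : Group π.ker) with
      mul_comm := fun a b => Subtype.ext (hcomm a a.2 b b.2) }
  let c : Q → π.ker := fun q => MulAut.conjNormal (s q) ⟨x, hx⟩
  have hc : ∀ e q, MulAut.conjNormal e (c q) = c (π e * q) := by
    intro e q
    apply Subtype.ext
    simp only [c, MulAut.conjNormal_apply]
    have hw : (s (π e * q))⁻¹ * (e * s q) ∈ π.ker := by
      simp [MonoidHom.mem_ker, hs]
    have h := hcomm _ hw x hx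
    have h2 : e * s q * x = s (π e * q) * x * (s (π e * q))⁻¹ * (e * s q) := by
      rw [mul_assoc (s (π e * q) * x), mul_assoc (s (π e * q)), ← h]
      group
    calc e * (s q * x * (s q)⁻¹) * e⁻¹ = (e * s q * x) * (s q)⁻¹ * e⁻¹ := by group
      _ = _ := by rw [h2]; group
  have hn : ((∏ q, c q : π.ker) : E) ∈ Subgroup.center E := by
    rw [Subgroup.mem_center_iff]
    intro e
    have h : MulAut.conjNormal e (∏ q, c q) = ∏ q, c q := by
      rw [map_prod]
      exact Fintype.prod_equiv (Equiv.mulLeft (π e)) _ _ (hc e)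
    have h' := congrArg Subtype.val h
    rw [MulAut.conjNormal_apply] at h'
    exact mul_inv_eq_iff_eq_mul.1 h'
  have hd : ∏ q, (c q * (⟨x, hx⟩ : π.ker)⁻¹) ∈ f.ker.subgroupOf π.ker := by
    refine Subgroup.prod_mem _ fun q _ => ?_
    rw [Subgroup.mem_subgroupOf, MonoidHom.mem_ker]
    change f (s q * x * (s q)⁻¹ * x⁻¹) = 1
    rw [map_mul, map_mul, map_mul, Subgroup.mem_center_iff.1 hfx (f (s q))]
    simp
  rw [Finset.prod_mul_distrib, Finset.prod_const, Finset.card_univ, ← Nat.card_eq_fintype_card,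
    Subgroup.mem_subgroupOf, MonoidHom.mem_ker] at hd
  have hd' : f (∏ q, c q : π.ker) * ((f x)⁻¹) ^ Nat.card Q = 1 := by
    rw [← map_inv, ← map_pow, ← map_mul]; exact hd
  rw [MonoidHom.mem_ker.1 (hZ hn), one_mul, inv_pow, inv_eq_one] at hd'
  have hfp : f x ^ p = 1 := by rw [← map_pow, hxp, map_one]
  have h := Nat.dvd_gcd (orderOf_dvd_of_pow_eq_one hfp) (orderOf_dvd_of_pow_eq_one hd')
  rw [hp.gcd_eq_one, Nat.dvd_one] at h
  exact orderOf_eq_one_iff.1 h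

theorem surjective_of_gen {A : Type u} (H : GenGroup A) {G : Type v} [Group G] {φ : A → G}
    (hφ : Subgroup.closure (Set.range φ) = ⊤) (f : H →* G) (hf : ∀ a, f (H.gen a) = φ a) :
    Function.Surjective f := by
  rw [← MonoidHom.range_eq_top, eq_top_iff, ← hφ, Subgroup.closure_le]
  rintro _ ⟨a, rfl⟩
  exact ⟨_, hf a⟩

theorem gaschutzProj_surjective {A : Type u} [Finite A] (p : ℕ) [Fact p.Prime] (G : GenGroup A) :
    Function.Surjective (gaschutzProj p G) :=
  surjective_of_gen _ G.closure_range_gen _ fun a => G.eval_of a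

open scoped commutatorElement in
theorem gaschutzProj_ker_comm {A : Type u} [Finite A] (p : ℕ) [Fact p.Prime] (G : GenGroup A) :
    ∀ x ∈ (gaschutzProj p G).ker, ∀ y ∈ (gaschutzProj p G).ker, x * y = y * x := by
  intro x hx y hy
  obtain ⟨r, rfl⟩ := QuotientGroup.mk'_surjective (powCommutator p G.eval.ker) x
  obtain ⟨s, rfl⟩ := QuotientGroup.mk'_surjective (powCommutator p G.eval.ker) y
  have h : QuotientGroup.mk' (powCommutator p G.eval.ker) ⁅r, s⁆ = 1 :=
    (QuotientGroup.eq_one_iff _).2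
      (Subgroup.mem_sup_right (Subgroup.commutator_mem_commutator hx hy))
  rw [map_commutatorElement] at h
  exact commutatorElement_eq_one_iff_mul_comm.1 h

theorem gaschutzProj_ker_pow {A : Type u} [Finite A] (p : ℕ) [Fact p.Prime] (G : GenGroup A) :
    ∀ x ∈ (gaschutzProj p G).ker, x ^ p = 1 := by
  intro x hx
  obtain ⟨r, rfl⟩ := QuotientGroup.mk'_surjective (powCommutator p G.eval.ker) x
  exact (map_pow (QuotientGroup.mk' (powCommutator p G.eval.ker)) r p).symm.trans
    ((QuotientGroup.eq_one_iff _).2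
      (Subgroup.mem_sup_left (Subgroup.subset_normalClosure ⟨r, hx, rfl⟩)))

/-- Universal property of the Gaschütz extension modulo its centre. -/
theorem exists_hom_modCenter_gaschutz {A : Type u} [Finite A] [Nontrivial A] (p : ℕ)
    [Fact p.Prime] (H : GenGroup A) {G : Type v} [Group G] {φ : A → G}
    (hφ : Subgroup.closure (Set.range φ) = ⊤) (N : Subgroup G) [N.Normal]
    (hcomm : ∀ x ∈ N, ∀ y ∈ N, x * y = y * x) (hpow : ∀ x ∈ N, x ^ p = 1)
    (hcen : ∀ x ∈ N, x ∈ Subgroup.center G → x = 1)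
    (g : H →* G ⧸ N) (hg : ∀ a, g (H.gen a) = φ a) :
    ∃ f : modCenter (gaschutz p H) →* G, ∀ a, f ((modCenter (gaschutz p H)).gen a) = φ a := by
  have hl : g.comp H.eval = (QuotientGroup.mk' N).comp (FreeGroup.lift φ) := by
    ext a
    simp [H.eval_of, hg]
  have hN : ∀ r ∈ H.eval.ker, FreeGroup.lift φ r ∈ N := by
    intro r hr
    have h := DFunLike.congr_fun hl r
    rw [MonoidHom.comp_apply, MonoidHom.mem_ker.1 hr, map_one] at h
    exact (QuotientGroup.eq_one_iff _).1 h.symm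
  have hker : powCommutator p H.eval.ker ≤ (FreeGroup.lift φ).ker := by
    refine sup_le (Subgroup.normalClosure_le_normal ?_) (Subgroup.commutator_le.2 ?_)
    · rintro _ ⟨r, hr, rfl⟩
      change FreeGroup.lift φ (r ^ p) = 1
      rw [map_pow, hpow _ (hN r hr)]
    · intro r hr s hs
      rw [MonoidHom.mem_ker, map_commutatorElement, commutatorElement_eq_one_iff_mul_comm]
      exact hcomm _ (hN r hr) _ (hN s hs)
  let e : gaschutz p H →* G := QuotientGroup.lift _ (FreeGroup.lift φ) hker
  have he : ∀ a, e ((gaschutz p H).gen a) = φ a := fun a => FreeGroup.lift_apply_of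
  have hes : Function.Surjective e := surjective_of_gen _ hφ e he
  refine ⟨QuotientGroup.lift (Subgroup.center (gaschutz p H)) e fun z hz => ?_, he⟩
  have hz1 := center_le_ker p H hz
  obtain ⟨r, rfl⟩ := QuotientGroup.mk'_surjective (powCommutator p H.eval.ker) z
  refine hcen _ (hN r hz1) (Subgroup.mem_center_iff.2 fun y => ?_)
  obtain ⟨y, rfl⟩ := hes y
  exact ((map_mul e _ _).symm.trans (congrArg e (Subgroup.mem_center_iff.1 hz y))).trans
    (map_mul e _ _)

theorem base_pow (A : Type u) [Finite A] (q : ℕ) [Fact q.Prime] (x : base A q) : x ^ q = 1 := by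
  funext a
  change Multiplicative.ofAdd (q • Multiplicative.toAdd (x a)) = 1
  simp

section Tower

variable (p : ℕ → ℕ) [∀ n, Fact (p n).Prime]

theorem exists_eq_of_prime_dvd_card_tower (A : Type u) [Finite A] (n : ℕ) {q : ℕ} (hq : q.Prime)
    (h : q ∣ Nat.card (tower p A n)) : ∃ i ≤ n, q = p i := by
  induction n with
  | zero =>
    refine ⟨0, le_rfl, ?_⟩
    have := Fact.mk hq
    obtain ⟨x, hx⟩ := exists_prime_orderOf_dvd_card' q h
    have h1 : q ∣ p 0 := hx ▸ orderOf_dvd_of_pow_eq_one (base_pow A (p 0) x)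
    exact (Nat.prime_dvd_prime_iff_eq hq Fact.out).1 h1
  | succ n ih =>
    have h1 : q ∣ Nat.card (gaschutz (p (n + 1)) (tower p A n)) :=
      h.trans (Subgroup.card_quotient_dvd_card _)
    have := Fact.mk hq
    obtain ⟨x, hx⟩ := exists_prime_orderOf_dvd_card' q h1
    by_cases hk : x ∈ (gaschutzProj (p (n + 1)) (tower p A n)).ker
    · have h2 := orderOf_dvd_of_pow_eq_one (gaschutzProj_ker_pow _ _ x hk)
      rw [hx] at h2
      exact ⟨n + 1, le_rfl, (Nat.prime_dvd_prime_iff_eq hq Fact.out).1 h2⟩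
    · have h2 : orderOf (gaschutzProj (p (n + 1)) (tower p A n) x) = q :=
        orderOf_eq_prime (by rw [← map_pow, ← hx, pow_orderOf_eq_one, map_one]) hk
      obtain ⟨i, hi, hqi⟩ := ih (h2 ▸ orderOf_dvd_natCard _)
      exact ⟨i, hi.trans n.le_succ, hqi⟩

theorem coprime_card_tower (hp : Function.Injective p) (A : Type u) [Finite A] (n : ℕ) :
    (p (n + 1)).Coprime (Nat.card (tower p A n)) := by
  refine (Nat.Prime.coprime_iff_not_dvd Fact.out).2 fun h => ?_
  obtain ⟨i, hi, h⟩ := exists_eq_of_prime_dvd_card_tower p A n Fact.out h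
  have := hp h
  omega

theorem exists_hom_base (A : Type u) [Finite A] (q : ℕ) [Fact q.Prime] {G : Type v} [Group G]
    (hcomm : ∀ x y : G, x * y = y * x) (hpow : ∀ x : G, x ^ q = 1) (φ : A → G) :
    ∃ f : base A q →* G, ∀ a, f ((base A q).gen a) = φ a := by
  classical
  have := Fintype.ofFinite A
  have h0 : ∀ a, zmultiplesHom (Additive G) (Additive.ofMul (φ a)) (q : ℤ) = 0 := by
    intro a
    rw [zmultiplesHom_apply, natCast_zsmul, ← ofMul_pow, hpow, ofMul_one]
  let l : A → Multiplicative (ZMod q) →* G := fun a =>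
    (ZMod.lift q ⟨_, h0 a⟩).toMultiplicativeLeft
  refine ⟨MonoidHom.noncommPiCoprod l fun _ _ _ _ _ => hcomm _ _, fun a => ?_⟩
  refine (MonoidHom.noncommPiCoprod_mulSingle _ _ _).trans ?_
  have h := ZMod.lift_coe q ⟨_, h0 a⟩ 1
  rw [Int.cast_one] at h
  change Additive.toMul (ZMod.lift q ⟨_, h0 a⟩ (1 : ZMod q)) = φ a
  rw [h]
  simp

theorem exists_tower_hom (hp : Function.Injective p) (A B : Type u) [Finite A] [Finite B]
    [Nontrivial A] (n : ℕ) : ∀ {G : Type v} [Group G] (f : tower p B n →* G)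
      (_ : Function.Surjective f) (φ : A → G) (_ : Subgroup.closure (Set.range φ) = ⊤),
      ∃ g : tower p A n →* G, ∀ a, g ((tower p A n).gen a) = φ a := by
  induction n with
  | zero =>
    intro G _ f hf φ hφ
    refine exists_hom_base A (p 0) (fun x y => ?_) (fun x => ?_) φ
    · obtain ⟨x, rfl⟩ := hf x
      obtain ⟨y, rfl⟩ := hf y
      rw [← map_mul, ← map_mul]
      exact congrArg f (mul_comm (G := B → Multiplicative (ZMod (p 0))) x y)
    · obtain ⟨x, rfl⟩ := hf x
      rw [← map_pow]
      exact (congrArg f (base_pow B (p 0) x)).trans (map_one f)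
  | succ n ih =>
    intro G _ f hf φ hφ
    let e : gaschutz (p (n + 1)) (tower p B n) →* G :=
      MonoidHom.comp f (QuotientGroup.mk' (Subgroup.center (gaschutz (p (n + 1)) (tower p B n))))
    have he : Function.Surjective e := hf.comp (QuotientGroup.mk'_surjective _)
    have hZ : Subgroup.center (gaschutz (p (n + 1)) (tower p B n)) ≤ e.ker := by
      intro z hz
      exact (congrArg f ((QuotientGroup.eq_one_iff z).2 hz)).trans (map_one f)
    let π := gaschutzProj (p (n + 1)) (tower p B n)
    have hπ : Function.Surjective π := gaschutzProj_surjective _ _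
    have hNn : (π.ker.map e).Normal := Subgroup.Normal.map inferInstance e he
    let k : tower p B n →* G ⧸ π.ker.map e :=
      π.liftOfSurjective hπ ⟨(QuotientGroup.mk' _).comp e, fun x hx =>
        (QuotientGroup.eq_one_iff _).2 ⟨x, hx, rfl⟩⟩
    have hk : ∀ x, k (π x) = QuotientGroup.mk' _ (e x) := fun x =>
      MonoidHom.liftOfRightInverse_comp_apply _ _ _ _ _
    have hks : Function.Surjective k := by
      intro y
      obtain ⟨y, rfl⟩ := QuotientGroup.mk'_surjective _ y
      obtain ⟨x, rfl⟩ := he y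
      exact ⟨π x, hk x⟩
    obtain ⟨g, hg⟩ := ih k hks (fun a => QuotientGroup.mk' _ (φ a)) (by
      rw [Set.range_comp' (QuotientGroup.mk' _) φ, ← MonoidHom.map_closure, hφ,
        ← MonoidHom.range_eq_map, MonoidHom.range_eq_top]
      exact QuotientGroup.mk'_surjective _)
    refine exists_hom_modCenter_gaschutz (p (n + 1)) (tower p A n) hφ (π.ker.map e) ?_ ?_ ?_ g hg
    · rintro _ ⟨x, hx, rfl⟩ _ ⟨y, hy, rfl⟩
      rw [← map_mul, ← map_mul, gaschutzProj_ker_comm _ _ x hx y hy]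
    · rintro _ ⟨x, hx, rfl⟩
      rw [← map_pow, gaschutzProj_ker_pow _ _ x hx, map_one]
    · rintro _ ⟨x, hx, rfl⟩ hc
      exact map_eq_one_of_mem_center π hπ (gaschutzProj_ker_comm _ _) e hZ
        (coprime_card_tower p hp B n) hx (gaschutzProj_ker_pow _ _ x hx) hc

end Tower

section Limit

variable (p : ℕ → ℕ) [∀ n, Fact (p n).Prime] (A : Type u) [Finite A] [Nontrivial A]

/-- The projection of the inverse limit onto the `n`-th term of the tower. -/
noncomputable def limitProj (n : ℕ) : limit p A →* tower p A n :=
  (Pi.evalMonoidHom (fun n => (tower p A n : Type u)) n).comp (limit p A).subtype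

theorem limitProj_gen (n : ℕ) (a : A) :
    limitProj p A n (limitGen p A a) = (tower p A n).gen a := rfl

theorem continuous_limitProj (n : ℕ) : Continuous (limitProj p A n) :=
  (continuous_apply n).comp continuous_subtype_val

theorem limitProj_surjective (n : ℕ) : Function.Surjective (limitProj p A n) := by
  rw [← MonoidHom.range_eq_top, eq_top_iff, ← (tower p A n).closure_range_gen, Subgroup.closure_le]
  rintro _ ⟨a, rfl⟩
  exact ⟨_, limitProj_gen p A n a⟩

theorem limitProj_eq_of_le {x y : limit p A} {m n : ℕ} (hmn : m ≤ n)
    (h : limitProj p A n x = limitProj p A n y) : limitProj p A m x = limitProj p A m y := by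
  induction n, hmn using Nat.le_induction with
  | base => exact h
  | succ n _ ih =>
    refine ih ?_
    have h' := congrArg (transition p A n) h
    exact (x.2 n).symm.trans (h'.trans (y.2 n))

/-- The cosets of the kernels of the projections form a base of the topology. -/
theorem exists_limitProj_subset {U : Set (limit p A)} (hU : IsOpen U) {x : limit p A}
    (hx : x ∈ U) : ∃ n, ∀ y, limitProj p A n y = limitProj p A n x → y ∈ U := by
  obtain ⟨V, hV, rfl⟩ := isOpen_induced_iff.1 hU
  obtain ⟨I, u, hu, hsub⟩ := isOpen_pi_iff.1 hV _ hx
  refine ⟨I.sup id, fun y hy => hsub fun i hi => ?_⟩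
  have h : limitProj p A i y = limitProj p A i x :=
    limitProj_eq_of_le p A (Finset.le_sup (f := id) hi) hy
  change limitProj p A i y ∈ u i
  rw [h]
  exact (hu i hi).2

theorem dense_closure_limitGen :
    Dense (Subgroup.closure (Set.range (limitGen p A)) : Set (limit p A)) := by
  refine dense_iff_inter_open.2 fun U hU ⟨x, hx⟩ => ?_
  obtain ⟨n, hn⟩ := exists_limitProj_subset p A hU hx
  have h : limitProj p A n x ∈
      (Subgroup.closure (Set.range (limitGen p A))).map (limitProj p A n) := by
    rw [MonoidHom.map_closure, ← Set.range_comp]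
    exact (tower p A n).closure_range_gen.symm ▸ Subgroup.mem_top _
  obtain ⟨y, hy, hyx⟩ := h
  exact ⟨y, hn y hyx, hy⟩

theorem isClosed_limit : IsClosed (limit p A : Set (∀ n, tower p A n)) := by
  have h : (limit p A : Set (∀ n, tower p A n)) =
      ⋂ n, {x | transition p A n (x (n + 1)) = x n} := by
    ext x
    simp [limit]
  rw [h]
  exact isClosed_iInter fun n => isClosed_eq
    (continuous_of_discreteTopology.comp (continuous_apply _)) (continuous_apply _)

instance (n : ℕ) : IsTopologicalGroup (tower p A n) where
  continuous_mul := continuous_of_discreteTopology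
  continuous_inv := continuous_of_discreteTopology

instance : CompactSpace (limit p A) := isCompact_iff_compactSpace.1 (isClosed_limit p A).isCompact

theorem isPro_limit (B : ℕ → Type u) [∀ t, Finite (B t)] (t : ℕ) (ht : 2 ≤ t)
    [Nontrivial (B t)] : IsPro p B (limit p (B t)) where
  isTopologicalGroup := inferInstance
  compactSpace := inferInstance
  t2Space := inferInstance
  totallyDisconnectedSpace := inferInstance
  quotient_mem N _ hN := by
    obtain ⟨n, hn⟩ := exists_limitProj_subset p (B t) hN N.one_mem
    refine ⟨n, t, ht, (limitProj p (B t) n).liftOfSurjective (limitProj_surjective p (B t) n)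
      ⟨QuotientGroup.mk' N, fun x hx => (QuotientGroup.eq_one_iff _).2 (hn x ?_)⟩, fun y => ?_⟩
    · rw [MonoidHom.mem_ker.1 hx, map_one]
    · obtain ⟨x, rfl⟩ := QuotientGroup.mk'_surjective N y
      exact ⟨limitProj p (B t) n x, MonoidHom.liftOfRightInverse_comp_apply _ _ _ _ _⟩

end Limit

/-- If `X` generates a dense subgroup of a compact group `H`, a map `μ` from `X` to a profinite group
`K` extends to `H` as soon as it does modulo every open normal subgroup. -/
theorem exists_continuousMonoidHom {X : Type*} {H : Type*} {K : Type*} [Group H]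
    [TopologicalSpace H] [IsTopologicalGroup H] [CompactSpace H] [T2Space H] [Group K]
    [TopologicalSpace K] [IsTopologicalGroup K] [CompactSpace K] [T2Space K]
    [TotallyDisconnectedSpace K] (ι : X → H) (μ : X → K)
    (hι : Dense (Subgroup.closure (Set.range ι) : Set H))
    (h : ∀ (N : Subgroup K) [N.Normal], IsOpen (N : Set K) →
      ∃ f : H →* K ⧸ N, Continuous f ∧ ∀ a, f (ι a) = μ a) :
    ∃ f : H →ₜ* K, ∀ a, f (ι a) = μ a := by
  let D : Subgroup (H × K) :=
    (Subgroup.closure (Set.range fun a => (ι a, μ a))).topologicalClosure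
  have hDc : IsClosed (D : Set (H × K)) := Subgroup.isClosed_topologicalClosure _
  have hDg : ∀ a, (ι a, μ a) ∈ D := fun a =>
    Subgroup.le_topologicalClosure _ (Subgroup.subset_closure ⟨a, rfl⟩)
  have : CompactSpace D := isCompact_iff_compactSpace.1 hDc.isCompact
  let π : D →* H := (MonoidHom.fst H K).comp D.subtype
  have hπc : Continuous π := continuous_fst.comp continuous_subtype_val
  have hsurj : Function.Surjective π := by
    rw [← Set.range_eq_univ, ← (isCompact_range hπc).isClosed.closure_eq,
      ← dense_iff_closure_eq]
    refine hι.mono ?_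
    rw [← MonoidHom.coe_range, SetLike.coe_subset_coe, Subgroup.closure_le]
    rintro _ ⟨a, rfl⟩
    exact ⟨⟨_, hDg a⟩, rfl⟩
  have hinj : Function.Injective π := by
    rw [injective_iff_map_eq_one]
    rintro ⟨⟨x, k⟩, hxk⟩ (hx : x = 1)
    subst hx
    have hk : k = 1 := by
      by_contra hk
      obtain ⟨N, hN⟩ := ProfiniteGrp.exist_openNormalSubgroup_sub_open_nhds_of_one
        (isOpen_compl_singleton (x := k)) (by simpa using Ne.symm hk)
      obtain ⟨f, hf, hfg⟩ := h N.toSubgroup N.isOpen'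
      have : DiscreteTopology (K ⧸ N.toSubgroup) := QuotientGroup.discreteTopology N.isOpen'
      have hle : D ≤ (f.comp (MonoidHom.fst H K)).eqLocus
          ((QuotientGroup.mk' N.toSubgroup).comp (MonoidHom.snd H K)) := by
        refine Subgroup.topologicalClosure_minimal _ ?_ ?_
        · rw [Subgroup.closure_le]
          rintro _ ⟨a, rfl⟩
          exact hfg a
        · exact isClosed_eq (hf.comp continuous_fst)
            (QuotientGroup.continuous_mk.comp continuous_snd)
      have h1 : f 1 = QuotientGroup.mk' N.toSubgroup k := hle hxk
      rw [map_one] at h1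
      exact hN ((QuotientGroup.eq_one_iff k).1 h1.symm) rfl
    subst hk
    rfl
  let e : D ≃* H := MulEquiv.ofBijective π ⟨hinj, hsurj⟩
  have he : Continuous e.symm :=
    (Continuous.homeoOfEquivCompactToT2 (f := e.toEquiv) hπc).symm.continuous
  refine ⟨⟨((MonoidHom.snd H K).comp D.subtype).comp e.symm.toMonoidHom,
    continuous_snd.comp (continuous_subtype_val.comp he)⟩, fun a => ?_⟩
  change (e.symm (ι a)).1.2 = μ a
  have h1 : e.symm (ι a) = ⟨_, hDg a⟩ := e.symm_apply_eq.2 rfl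
  rw [h1]

theorem inClass_generated_iff (p : ℕ → ℕ) [∀ n, Fact (p n).Prime] (hp : Function.Injective p)
    (A : ℕ → Type u) [∀ t, Finite (A t)] (t : ℕ) (ht : 2 ≤ t) [Nontrivial (A t)]
    (G : Type v) [Group G] (φ : A t → G) :
    (Subgroup.closure (Set.range φ) = ⊤ ∧ InClass p A G) ↔
      ∃ (n : ℕ) (f : tower p (A t) n →* G), Function.Surjective f ∧
        ∀ a, f ((tower p (A t) n).gen a) = φ a := by
  constructor
  · rintro ⟨hφ, n, s, -, f, hf⟩
    obtain ⟨g, hg⟩ := exists_tower_hom p hp (A t) (A s) n f hf φ hφ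
    exact ⟨n, g, surjective_of_gen _ hφ g hg, hg⟩
  · rintro ⟨n, f, hf, hg⟩
    refine ⟨?_, n, t, ht, f, hf⟩
    have h : φ = f ∘ (tower p (A t) n).gen := funext fun a => (hg a).symm
    rw [h, Set.range_comp, ← MonoidHom.map_closure, (tower p (A t) n).closure_range_gen,
      ← MonoidHom.range_eq_map, MonoidHom.range_eq_top.2 hf]

theorem closure_mk_eq_top_of_dense {X : Type*} {K : Type*} [Group K] [TopologicalSpace K]
    [IsTopologicalGroup K] (μ : X → K) (hμ : Dense (Subgroup.closure (Set.range μ) : Set K))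
    (N : Subgroup K) [N.Normal] (hN : IsOpen (N : Set K)) :
    Subgroup.closure (Set.range fun a => (μ a : K ⧸ N)) = ⊤ := by
  have : DiscreteTopology (K ⧸ N) := QuotientGroup.discreteTopology hN
  have h := (QuotientGroup.mk'_surjective N).denseRange.dense_image
    QuotientGroup.continuous_mk hμ
  rw [← Subgroup.coe_map, MonoidHom.map_closure, ← Set.range_comp, dense_discrete] at h
  exact SetLike.coe_injective h

theorem isFreePro_limit (p : ℕ → ℕ) [∀ n, Fact (p n).Prime] (hp : Function.Injective p)
    (A : ℕ → Type u) [∀ t, Finite (A t)] (t : ℕ) (ht : 2 ≤ t) [Nontrivial (A t)] :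
    IsFreePro.{u, u, u, v} p A (A t) (limit p (A t)) (limitGen p (A t)) where
  isPro := isPro_limit p A t ht
  dense := dense_closure_limitGen p (A t)
  lift K _ _ hK μ hμ := by
    have := hK.isTopologicalGroup
    have := hK.compactSpace
    have := hK.t2Space
    have := hK.totallyDisconnectedSpace
    obtain ⟨f, hf⟩ := exists_continuousMonoidHom (limitGen p (A t)) μ
      (dense_closure_limitGen p (A t)) fun N _ hN => by
        obtain ⟨n, g, -, hg⟩ := (inClass_generated_iff p hp A t ht (K ⧸ N) fun a => μ a).1
          ⟨closure_mk_eq_top_of_dense μ hμ N hN, hK.quotient_mem N hN⟩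
        exact ⟨g.comp (limitProj p (A t) n),
          (continuous_of_discreteTopology (f := g)).comp (continuous_limitProj p (A t) n), hg⟩
    refine ⟨f, hf, fun g hg => ?_⟩
    have h : Subgroup.closure (Set.range (limitGen p (A t))) ≤
        (g : limit p (A t) →* K).eqLocus (f : limit p (A t) →* K) := by
      rw [Subgroup.closure_le]
      rintro _ ⟨a, rfl⟩
      exact (hg a).trans (hf a).symm
    exact DFunLike.coe_injective (Continuous.ext_on (dense_closure_limitGen p (A t))
      g.continuous_toFun f.continuous_toFun h)

end GaschutzTower

theorem mainTheorem11 (p : ℕ → ℕ) [∀ n, Fact (p n).Prime] (hp : Function.Injective p)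
    (A : ℕ → Type u) [∀ t, Finite (A t)] (hA : ∀ t, 2 ≤ t → Nat.card (A t) = t)
    (t : ℕ) (ht : 2 ≤ t) [Nontrivial (A t)] :
    (∀ (G : Type v) [Group G] (φ : A t → G),
      (Subgroup.closure (Set.range φ) = ⊤ ∧ GaschutzTower.InClass p A G) ↔
        ∃ (n : ℕ) (f : GaschutzTower.tower p (A t) n →* G), Function.Surjective f ∧
          ∀ a, f ((GaschutzTower.tower p (A t) n).gen a) = φ a) ∧
    GaschutzTower.IsFreePro.{u, u, u, v} p A (A t) (GaschutzTower.limit p (A t))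
      (GaschutzTower.limitGen p (A t)) :=
  ⟨fun G _ φ => GaschutzTower.inClass_generated_iff p hp A t ht G φ,
    GaschutzTower.isFreePro_limit p hp A t ht⟩
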